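/- Let $G=(V,E)$ be a finite simple graph with $V\neq\emptyset$. The vertex packing polytope $VP(G)\subset\mathbb{R}^V$ is the convex hull of the characteristic vectors of the independent sets of $G$. For a probability distribution $P=(p_v)_{v\in V}$ on $V$, the graph entropy of $G$ with respect to $P$ is \[ H(G,P)=\min_{a\in VP(G)}\ \sum_{v\in V}p_v\log_2\frac1{a_v}, \] where a term with $p_v=0$ is read as $0$ and a term with $p_v>0$, $a_v=0$ is read as $+\infty$. Theorem. Let $G$ be a perfect graph, i.e. every induced subgraph of $G$ has chromatic number equal to its clique number. Then the uniform distribution $U$ on $V$ maximizes the graph entropy, i.e. $H(G,P)\le H(G,U)$ for every probability distribution $P$ on $V$, if and only if $V$ can be partitioned into (pairwise disjoint) cliques of $G$, each of the maximum size $\omega(G)$. -/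

import Mathlib

namespace GraphEntropy

/-- A finite graph is perfect if every induced subgraph (including the graph itself) has
chromatic number equal to its clique number. -/
def IsPerfect {V : Type*} (G : SimpleGraph V) : Prop :=
  ∀ s : Set V, (G.induce s).chromaticNumber = ((G.induce s).cliqueNum : ℕ∞)

/-- The vertex packing polytope `VP(G)`: the convex hull of the characteristic vectors of the
independent sets of `G`. -/
def vertexPackingPolytope {V : Type*} (G : SimpleGraph V) : Set (V → ℝ) :=
  convexHull ℝ {x | ∃ S : Set V, G.IsIndepSet S ∧ x = S.indicator (fun _ => (1 : ℝ))}

/-- The points of `VP(G)` at which `∑ v, P v * log (1 / a v)` is finite, where a term with `P v = 0`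
counts as `0` and a term with `P v > 0`, `a v = 0` counts as `+∞`. -/
def finiteSet {V : Type*} (G : SimpleGraph V) (P : V → ℝ) : Set (V → ℝ) :=
  {a | a ∈ vertexPackingPolytope G ∧ ∀ v, 0 < P v → 0 < a v}

/-- The objective function `∑ v, P v * log₂ (1 / a v)`. -/
noncomputable def objective {V : Type*} [Fintype V] (P a : V → ℝ) : ℝ :=
  ∑ v, P v * Real.logb 2 (1 / a v)

/-- The entropy `H(G,P) = min_{a ∈ VP(G)} ∑ v, P v * log₂ (1 / a v)`. Points of `VP(G)` at which
the sum is `+∞` do not matter for the minimum and are left out; `isLeast_graphEntropy` below shows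
that for a probability distribution `P` the minimum exists and that this is its value. -/
noncomputable def graphEntropy {V : Type*} [Fintype V] (G : SimpleGraph V) (P : V → ℝ) : ℝ :=
  sInf (objective P '' finiteSet G P)

/-- The uniform distribution on the vertex set. -/
noncomputable def uniformDist (V : Type*) [Fintype V] : V → ℝ :=
  fun _ => 1 / (Fintype.card V : ℝ)

/-- `G` is symmetric with respect to graph entropy: among all probability distributions `P` on the
vertices, the uniform one maximizes `H(G,P)` (it need not be the only maximizer). -/
def IsSymmetric {V : Type*} [Fintype V] (G : SimpleGraph V) : Prop :=
  uniformDist V ∈ stdSimplex ℝ V ∧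
    ∀ P ∈ stdSimplex ℝ V, graphEntropy G P ≤ graphEntropy G (uniformDist V)

theorem uniformDist_mem (V : Type*) [Fintype V] [Nonempty V] :
    uniformDist V ∈ stdSimplex ℝ V := by
  refine ⟨fun _ => by unfold uniformDist; positivity, ?_⟩
  simp [uniformDist]

theorem vertexPackingPolytope_isCompact {V : Type*} [Fintype V] (G : SimpleGraph V) :
    IsCompact (vertexPackingPolytope G) := by
  refine Set.Finite.isCompact_convexHull (𝕜 := ℝ) ?_
  refine (Set.finite_range (fun S : Set V => S.indicator (fun _ => (1 : ℝ)))).subset ?_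
  rintro x ⟨S, -, rfl⟩
  exact ⟨S, rfl⟩

theorem vertexPackingPolytope_subset {V : Type*} (G : SimpleGraph V) :
    vertexPackingPolytope G ⊆ Set.Icc 0 1 := by
  refine convexHull_min ?_ (convex_Icc 0 1)
  rintro x ⟨S, -, rfl⟩
  refine ⟨fun v => ?_, fun v => ?_⟩
  · exact Set.indicator_nonneg (fun _ _ => zero_le_one) v
  · exact Set.indicator_le_self' (f := fun _ => (1 : ℝ)) (fun _ _ => zero_le_one) v

theorem uniformDist_mem_vertexPackingPolytope {V : Type*} [Fintype V] [Nonempty V]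
    (G : SimpleGraph V) : uniformDist V ∈ vertexPackingPolytope G := by
  classical
  have h : uniformDist V =
      ∑ v : V, uniformDist V v • (({v} : Set V).indicator (fun _ => (1 : ℝ))) := by
    ext w
    simp [uniformDist, Finset.sum_apply, Pi.single_apply]
  rw [h]
  refine (convex_convexHull ℝ _).sum_mem (fun v _ => (uniformDist_mem V).1 v)
    (uniformDist_mem V).2 (fun v _ => subset_convexHull ℝ _ ⟨{v}, ?_, rfl⟩)
  exact Set.pairwise_singleton _ _

/-- The minimum in the definition of the entropy is attained. -/
theorem isLeast_graphEntropy {V : Type*} [Fintype V] (G : SimpleGraph V) {P : V → ℝ}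
    (hP : P ∈ stdSimplex ℝ V) :
    IsLeast (objective P '' finiteSet G P) (graphEntropy G P) := by
  have hne : Nonempty V := by
    by_contra h
    rw [not_nonempty_iff] at h
    simpa using hP.2
  have hu : ∀ v, 0 < uniformDist V v := fun v => by unfold uniformDist; positivity
  have hterm : ∀ a ∈ vertexPackingPolytope G, ∀ v, 0 ≤ P v * Real.logb 2 (1 / a v) := by
    intro a ha v
    have h := vertexPackingPolytope_subset G ha
    refine mul_nonneg (hP.1 v) ?_
    rw [one_div, Real.logb_inv, neg_nonneg]
    exact Real.logb_nonpos one_lt_two (h.1 v) (h.2 v)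
  set M := objective P (uniformDist V) with hM
  let K : Set (V → ℝ) :=
    vertexPackingPolytope G ∩ {a | ∀ v, 0 < P v → (2 : ℝ) ^ (-(M / P v)) ≤ a v}
  have hKc : IsCompact K := by
    refine (vertexPackingPolytope_isCompact G).inter_right ?_
    simp only [Set.ofPred_forall]
    exact isClosed_iInter fun v => isClosed_iInter fun _ =>
      isClosed_le continuous_const (continuous_apply v)
  have hKsub : K ⊆ finiteSet G P := fun a ha =>
    ⟨ha.1, fun v hv => (Real.rpow_pos_of_pos two_pos _).trans_le (ha.2 v hv)⟩
  have hmem : ∀ a ∈ finiteSet G P, objective P a ≤ M → a ∈ K := by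
    intro a ha hle
    refine ⟨ha.1, fun v hv => ?_⟩
    have h1 : P v * Real.logb 2 (1 / a v) ≤ M :=
      (Finset.single_le_sum (fun w _ => hterm a ha.1 w) (Finset.mem_univ v)).trans hle
    rw [← Real.le_logb_iff_rpow_le one_lt_two (ha.2 v hv)]
    rw [one_div, Real.logb_inv] at h1
    have h2 : -Real.logb 2 (a v) ≤ M / P v := by
      rw [le_div_iff₀ hv]; linarith
    linarith
  have huK : uniformDist V ∈ K :=
    hmem _ ⟨uniformDist_mem_vertexPackingPolytope G, fun v _ => hu v⟩ le_rfl
  have hcont : ContinuousOn (objective P) K := by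
    unfold objective
    refine continuousOn_finsetSum _ fun v _ => ?_
    rcases (hP.1 v).eq_or_lt with h0 | h0
    · simp only [← h0, zero_mul]
      exact continuousOn_const
    · refine continuousOn_const.mul ?_
      have hpos : ∀ a ∈ K, a v ≠ 0 := fun a ha => ((hKsub ha).2 v h0).ne'
      have hc : ContinuousOn (fun a : V → ℝ => a v) K := (continuous_apply v).continuousOn
      exact ((continuousOn_const.div hc hpos).log
        fun a ha => one_div_ne_zero (hpos a ha)).div_const _
  obtain ⟨b, hbK, hb⟩ := hKc.exists_isMinOn ⟨_, huK⟩ hcont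
  have hleast : IsLeast (objective P '' finiteSet G P) (objective P b) := by
    refine ⟨⟨b, hKsub hbK, rfl⟩, ?_⟩
    rintro _ ⟨a, ha, rfl⟩
    rcases le_total (objective P a) M with h | h
    · exact hb (hmem a ha h)
    · exact (hb huK).trans h
  have : graphEntropy G P = objective P b := hleast.csInf_eq
  rwa [this]

end GraphEntropy

/-!
Write `ω` for the clique number and `n` for the number of vertices.

*Entropy.* Since `log` lies below its tangent, `∑ P v * log₂ (1 / a v) ≥ log₂ ω` as soon as the
`P`-mean of `a` is at most `1 / ω` (`logb_le_objective`). As every clique has total weight at most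
`1` under a point of `VP(G)`, this gives `log₂ ω` as a lower bound for the entropy of the uniform
distribution on a maximum clique, and of the uniform distribution on `V` if `V` is partitioned into
maximum cliques. On the other hand `ω` colours suffice for a perfect graph, so the constant vector
`1 / ω` lies in `VP(G)` and every entropy is at most `log₂ ω`. Hence the largest entropy is exactly
`log₂ ω`, and a partition into maximum cliques makes the uniform distribution attain it.

*Converse.* If the uniform distribution attains `log₂ ω`, the constant vector `1 / ω` minimizes its
objective, and the first-order condition in the direction of an independent set `A` reads
`#A * ω ≤ n` (`card_mul_le_of_logb_le_graphEntropy`). So no independent set has more than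
`⌊n / ω⌋` vertices. By the weak perfect graph theorem (`IsPerfect.exists_clique_cover`), `V` is
covered by `⌊n / ω⌋` disjoint cliques; their sizes are at most `ω` and add up to `n`, so all of
them are maximum cliques.

*Weak perfect graph theorem.* Lovász's argument needs perfection to survive the replication of
vertices. `IsPerfect.exists_weighted_coloring` states this without constructing the blown-up graph,
as a colouring of vertex weights in which a vertex of weight `w v` lies in `w v` colour classes.
-/

namespace GraphEntropy

variable {V : Type*} [DecidableEq V] {G : SimpleGraph V}

/-! ### Weighted colourings and clique covers of perfect graphs -/

theorem card_clique_inter_indepSet_le_one {Q A : Finset V} (hQ : G.IsClique (Q : Set V))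
    (hA : G.IsIndepSet (A : Set V)) : (Q ∩ A).card ≤ 1 := by
  refine Finset.card_le_one.2 fun a ha b hb => ?_
  rw [Finset.mem_inter] at ha hb
  by_contra hne
  exact hA ha.2 hb.2 hne (hQ ha.1 hb.1 hne)

theorem sum_card_filter_mem {ι : Type*} [Fintype ι] (S : ι → Finset V) (Q : Finset V) :
    ∑ v ∈ Q, (Finset.univ.filter fun i => v ∈ S i).card = ∑ i, (Q ∩ S i).card := by
  simp_rw [Finset.card_filter, ← Finset.filter_mem_eq_inter, Finset.card_filter]
  exact Finset.sum_comm

variable [Fintype V]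

/-- For weights `0` and `1`, a weighted colouring is a colouring of the subgraph induced on the
support of `w`, and perfection applies directly. -/
theorem IsPerfect.exists_coloring_of_le_one (hG : IsPerfect G) (w : V → ℕ) (k : ℕ)
    (hw : ∀ v, w v ≤ 1) (hk : ∀ Q : Finset V, G.IsClique (Q : Set V) → ∑ v ∈ Q, w v ≤ k) :
    ∃ S : Fin k → Finset V, (∀ i, G.IsIndepSet (S i : Set V)) ∧
      ∀ v, (Finset.univ.filter fun i => v ∈ S i).card = w v := by
  classical
  have hcol : (G.induce {v | w v ≠ 0}).Colorable k := by
    rw [← SimpleGraph.chromaticNumber_le_iff_colorable, hG]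
    obtain ⟨t, ht⟩ := (G.induce {v | w v ≠ 0}).exists_isNClique_cliqueNum
    have hcl : G.IsClique ((t.map (Function.Embedding.subtype _) : Finset V) : Set V) := by
      intro a ha b hb hab
      simp only [Finset.coe_map, Set.mem_image, Finset.mem_coe] at ha hb
      obtain ⟨a, ha, rfl⟩ := ha
      obtain ⟨b, hb, rfl⟩ := hb
      exact ht.isClique ha hb (fun h => hab (by rw [h]))
    have h := hk _ hcl
    rw [Finset.sum_map] at h
    have h1 : ∀ x ∈ t, w ((Function.Embedding.subtype _) x) = 1 := fun x _ =>
      le_antisymm (hw _) (Nat.one_le_iff_ne_zero.2 x.2)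
    rw [Finset.sum_congr rfl h1, Finset.sum_const, ht.card_eq] at h
    simpa using h
  obtain ⟨c⟩ := hcol
  refine ⟨fun i => Finset.univ.filter fun v => ∃ h : w v ≠ 0, c ⟨v, h⟩ = i, fun i => ?_,
    fun v => ?_⟩
  · intro a ha b hb _ hadj
    simp only [Finset.coe_filter, Finset.mem_univ, true_and, Set.mem_ofPred_eq] at ha hb
    obtain ⟨ha, rfl⟩ := ha
    obtain ⟨hb, hab⟩ := hb
    exact c.valid (v := ⟨a, ha⟩) (w := ⟨b, hb⟩) hadj hab.symm
  · by_cases h : w v = 0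
    · simp [h]
    · have : w v = 1 := le_antisymm (hw _) (Nat.one_le_iff_ne_zero.2 h)
      simp [this, Finset.filter_eq]

/-- Every vertex weighting of a perfect graph is the sum of `k` characteristic functions of
independent sets, where `k` bounds the weight of every clique. In graph terms: blowing up the
vertices of a perfect graph to cliques keeps the chromatic number equal to the clique number. -/
theorem IsPerfect.exists_weighted_coloring (hG : IsPerfect G) (w : V → ℕ) (k : ℕ)
    (hk : ∀ Q : Finset V, G.IsClique (Q : Set V) → ∑ v ∈ Q, w v ≤ k) :
    ∃ S : Fin k → Finset V, (∀ i, G.IsIndepSet (S i : Set V)) ∧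
      ∀ v, (Finset.univ.filter fun i => v ∈ S i).card = w v := by
  induction hn : ∑ v, w v using Nat.strong_induction_on generalizing w k with
  | _ n ih =>
  subst hn
  by_cases hw : ∀ v, w v ≤ 1
  · exact hG.exists_coloring_of_le_one w k hw hk
  push Not at hw
  obtain ⟨x, hx⟩ := hw
  -- Lower the weight of `x` by one, colour, and pick a colour class `S i` through `x`.
  obtain ⟨S, hS, hSw⟩ := ih (∑ v, (w v - if v = x then 1 else 0))
    (Finset.sum_lt_sum (fun v _ => Nat.sub_le _ _) ⟨x, Finset.mem_univ x, by simp; omega⟩)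
    (fun v => w v - if v = x then 1 else 0) k
    (fun Q hQ => (Finset.sum_le_sum fun v _ => Nat.sub_le _ _).trans (hk Q hQ)) rfl
  obtain ⟨i, hi⟩ : ∃ i, x ∈ S i := by
    have : 0 < (Finset.univ.filter fun i => x ∈ S i).card := by
      rw [hSw]; simp; omega
    obtain ⟨i, hi⟩ := Finset.card_pos.1 this
    exact ⟨i, by simpa using hi⟩
  obtain ⟨m, rfl⟩ : ∃ m, k = m + 1 := Nat.exists_eq_succ_of_ne_zero (by
    rintro rfl; exact i.elim0)
  have hpos : ∀ v ∈ S i, 1 ≤ w v := fun v hv => by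
    have : 0 < (Finset.univ.filter fun j => v ∈ S j).card :=
      Finset.card_pos.2 ⟨i, by simpa using hv⟩
    rw [hSw] at this
    omega
  have hadd : ∀ v, (w v - if v ∈ S i then 1 else 0) + (if v ∈ S i then 1 else 0) = w v := by
    intro v
    split_ifs with h
    · have := hpos v h; omega
    · rfl
  -- Removing `S i` from the original weights lowers the clique bound: a clique that meets `S i`
  -- loses weight, and a clique that avoids `S i` also avoids `x`, so that its weight is spread over
  -- the `m` other classes, each of which meets it at most once.
  have hk' : ∀ Q : Finset V, G.IsClique (Q : Set V) →
      ∑ v ∈ Q, (w v - if v ∈ S i then 1 else 0) ≤ m := by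
    intro Q hQ
    have h1 := hk Q hQ
    rw [← Finset.sum_congr rfl fun v _ => hadd v, Finset.sum_add_distrib, ← Finset.card_filter,
      Finset.filter_mem_eq_inter] at h1
    rcases Nat.eq_zero_or_pos (Q ∩ S i).card with h0 | h0
    · have hdisj : ∀ v ∈ Q, v ∉ S i := fun v hv hvS => by
        rw [Finset.card_eq_zero] at h0
        exact Finset.notMem_empty v (h0 ▸ Finset.mem_inter.2 ⟨hv, hvS⟩)
      have h2 : ∑ v ∈ Q, (w v - if v ∈ S i then 1 else 0) = ∑ j, (Q ∩ S j).card := by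
        rw [← sum_card_filter_mem]
        refine Finset.sum_congr rfl fun v hv => ?_
        have hvx : v ≠ x := by rintro rfl; exact hdisj _ hv hi
        simp [hSw, hdisj v hv, hvx]
      rw [h2, ← Finset.add_sum_erase _ _ (Finset.mem_univ i), h0, zero_add]
      refine (Finset.sum_le_card_nsmul _ _ 1 fun j _ =>
        card_clique_inter_indepSet_le_one hQ (hS j)).trans ?_
      simp
    · omega
  obtain ⟨T, hT, hTw⟩ := ih (∑ v, (w v - if v ∈ S i then 1 else 0))
    (Finset.sum_lt_sum (fun v _ => Nat.sub_le _ _) ⟨x, Finset.mem_univ x, by simp [hi]; omega⟩)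
    (fun v => w v - if v ∈ S i then 1 else 0) m hk' rfl
  refine ⟨Fin.cons (S i) T, fun j => ?_, fun v => ?_⟩
  · refine Fin.cases ?_ (fun j => ?_) j
    · simpa using hS i
    · simpa using hT j
  · rw [Finset.card_filter, Fin.sum_univ_succ]
    simp only [Fin.cons_zero, Fin.cons_succ]
    rw [← Finset.card_filter, hTw, add_comm]
    exact hadd v

/-- In a perfect graph, some clique inside `s` meets all independent subsets of `s` of the maximum
size `k + 1`. -/
theorem IsPerfect.exists_clique_inter_indepSet (hG : IsPerfect G) (s : Finset V) (k : ℕ)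
    (hs : ∀ A : Finset V, A ⊆ s → G.IsIndepSet (A : Set V) → A.card ≤ k + 1) :
    ∃ Q ⊆ s, G.IsClique (Q : Set V) ∧
      ∀ A : Finset V, A ⊆ s \ Q → G.IsIndepSet (A : Set V) → A.card ≤ k := by
  classical
  by_contra! hcon
  choose! A hAs hA hAk using hcon
  set C := s.powerset.filter fun Q : Finset V => G.IsClique (Q : Set V) with hC
  have hmem : ∀ Q, Q ∈ C ↔ Q ⊆ s ∧ G.IsClique (Q : Set V) := fun Q => by simp [hC]
  have hpos : 0 < C.card := Finset.card_pos.2 ⟨∅, by simp [hmem]⟩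
  -- Weigh a vertex by the number of chosen sets `A Q` that contain it. A clique `Q` misses `A Q`
  -- and meets every other chosen set at most once, so its weight is at most `#C - 1`.
  obtain ⟨S, hS, hSw⟩ := hG.exists_weighted_coloring
    (fun v => (Finset.univ.filter fun Q : C => v ∈ A Q).card) (C.card - 1) (fun Q hQ => by
      rw [sum_card_filter_mem]
      have hQ' : Q ∩ s ∈ C := (hmem _).2 ⟨Finset.inter_subset_right,
        hQ.subset (by exact_mod_cast Finset.inter_subset_left)⟩
      have h0 : (Q ∩ A (Q ∩ s)).card = 0 := by
        rw [Finset.card_eq_zero, ← Finset.disjoint_iff_inter_eq_empty, Finset.disjoint_left]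
        intro v hv hvA
        have := Finset.mem_sdiff.1 (hAs _ ((hmem _).1 hQ').1 ((hmem _).1 hQ').2 hvA)
        exact this.2 (Finset.mem_inter.2 ⟨hv, this.1⟩)
      rw [← Finset.add_sum_erase _ _ (Finset.mem_univ (⟨Q ∩ s, hQ'⟩ : C)), h0, zero_add]
      refine (Finset.sum_le_card_nsmul _ _ 1 fun R _ =>
        card_clique_inter_indepSet_le_one hQ (hA _ ((hmem _).1 R.2).1 ((hmem _).1 R.2).2)).trans ?_
      simp [Finset.card_erase_of_mem])
  -- Count the total weight of `s` in both ways.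
  have h1 := sum_card_filter_mem S s
  rw [Finset.sum_congr rfl fun v _ => hSw v, sum_card_filter_mem] at h1
  have h2 : ∑ i, (s ∩ S i).card ≤ (C.card - 1) * (k + 1) := by
    refine (Finset.sum_le_card_nsmul _ _ (k + 1) fun i _ => hs _ Finset.inter_subset_left
      ((hS i).mono (by exact_mod_cast Finset.inter_subset_right))).trans ?_
    simp
  have h3 : C.card * (k + 1) ≤ ∑ Q : C, (s ∩ A Q).card := by
    refine le_trans ?_ (Finset.card_nsmul_le_sum _ _ (k + 1) fun Q _ => ?_)
    · simp
    · obtain ⟨hQs, hQ⟩ := (hmem _).1 Q.2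
      rw [Finset.inter_eq_right.2 ((hAs _ hQs hQ).trans Finset.sdiff_subset)]
      exact hAk _ hQs hQ
  have h4 : (C.card - 1) * (k + 1) < C.card * (k + 1) :=
    Nat.mul_lt_mul_of_pos_right (by omega) (by omega)
  omega

/-- A perfect graph without independent sets of more than `k` vertices is covered by `k` cliques.
Since this holds for all induced subgraphs, complements of perfect graphs are perfect. -/
theorem IsPerfect.exists_clique_cover (hG : IsPerfect G) (s : Finset V) (k : ℕ)
    (hs : ∀ A : Finset V, A ⊆ s → G.IsIndepSet (A : Set V) → A.card ≤ k) :
    ∃ c : V → ℕ, (∀ v ∈ s, c v < k) ∧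
      ∀ u ∈ s, ∀ v ∈ s, c u = c v → u ≠ v → G.Adj u v := by
  induction k generalizing s with
  | zero =>
    have : ∀ v, v ∉ s := fun v hv => by
      simpa using hs {v} (by simpa using hv) (by simp [SimpleGraph.IsIndepSet])
    exact ⟨fun _ => 0, fun v hv => (this v hv).elim, fun v hv => (this v hv).elim⟩
  | succ k ih =>
    obtain ⟨Q, -, hQ, hQA⟩ := hG.exists_clique_inter_indepSet s k hs
    obtain ⟨c, hc, hadj⟩ := ih (s \ Q) hQA
    have hcs : ∀ v ∈ s, v ∉ Q → c v < k := fun v hv h => hc v (Finset.mem_sdiff.2 ⟨hv, h⟩)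
    refine ⟨fun v => if v ∈ Q then k else c v, fun v hv => ?_, fun u hu v hv huv hne => ?_⟩
    · dsimp only
      split_ifs with h
      · exact Nat.lt_succ_self k
      · exact (hcs v hv h).trans (Nat.lt_succ_self k)
    · dsimp only at huv
      split_ifs at huv with h1 h2 h2
      · exact hQ h1 h2 hne
      · exact absurd huv (hcs v hv h2).ne'
      · exact absurd huv (hcs u hu h1).ne
      · exact hadj u (Finset.mem_sdiff.2 ⟨hu, h1⟩) v (Finset.mem_sdiff.2 ⟨hv, h2⟩) huv hne

/-- If no independent set has more than `|V| / ω` vertices, then the cliques of a cover by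
`⌊|V| / ω⌋` cliques all have to be maximum cliques. -/
theorem IsPerfect.exists_finpartition (hG : IsPerfect G) {K : Finset V}
    (hK : G.IsMaximumClique K) (hpos : 0 < K.card)
    (hA : ∀ A : Finset V, G.IsIndepSet (A : Set V) → A.card * K.card ≤ Fintype.card V) :
    ∃ 𝒬 : Finpartition (Finset.univ : Finset V), ∀ Q ∈ 𝒬.parts, G.IsMaximumClique Q := by
  classical
  set k := Fintype.card V / K.card with hk
  obtain ⟨c, hc, hadj⟩ := hG.exists_clique_cover Finset.univ k fun A _ h =>
    (Nat.le_div_iff_mul_le hpos).2 (hA A h)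
  have hcl : ∀ i, G.IsClique ((Finset.univ.filter fun v => c v = i : Finset V) : Set V) := by
    intro i u hu v hv huv
    simp only [Finset.coe_filter, Finset.mem_univ, true_and, Set.mem_ofPred_eq] at hu hv
    exact hadj u (Finset.mem_univ _) v (Finset.mem_univ _) (hu.trans hv.symm) huv
  have hle : ∀ i ∈ Finset.range k, (Finset.univ.filter fun v => c v = i).card ≤ K.card :=
    fun i _ => hK.maximum _ (hcl i)
  have hsum : Fintype.card V = ∑ i ∈ Finset.range k, (Finset.univ.filter fun v => c v = i).card :=
    Finset.card_eq_sum_card_fiberwise fun v _ => by simpa using hc v (Finset.mem_univ v)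
  have heq : ∀ i ∈ Finset.range k, (Finset.univ.filter fun v => c v = i).card = K.card := by
    refine (Finset.sum_eq_sum_iff_of_le hle).1 (le_antisymm (Finset.sum_le_sum hle) ?_)
    rw [← hsum, Finset.sum_const, Finset.card_range, smul_eq_mul]
    exact Nat.div_mul_le_self _ _
  refine ⟨Finpartition.ofSetoid (Setoid.ker c), fun Q hQ => ?_⟩
  obtain ⟨a, ha⟩ : ∃ a, a ∈ Q := Finpartition.nonempty_of_mem_parts _ hQ
  have hQ' : Q = Finset.univ.filter fun v => c v = c a := by
    ext b
    rw [← Finpartition.part_eq_of_mem _ hQ ha, Finpartition.mem_part_ofSetoid_iff_rel]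
    simp [Setoid.ker_def, eq_comm]
  subst hQ'
  exact ⟨hcl _, fun t ht => (hK.maximum t ht).trans
    (heq _ (Finset.mem_range.2 (hc a (Finset.mem_univ a)))).ge⟩

/-! ### Entropy bounds from the clique number -/

theorem sum_clique_le_one {a : V → ℝ} (ha : a ∈ vertexPackingPolytope G) {Q : Finset V}
    (hQ : G.IsClique (Q : Set V)) : ∑ v ∈ Q, a v ≤ 1 := by
  classical
  have hconv : Convex ℝ {a : V → ℝ | ∑ v ∈ Q, a v ≤ 1} := by
    refine convex_halfSpace_le ⟨fun x y => ?_, fun r x => ?_⟩ 1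
    · simp [Finset.sum_add_distrib]
    · simp [Finset.mul_sum]
  refine convexHull_min ?_ hconv ha
  rintro x ⟨S, hS, rfl⟩
  have h := card_clique_inter_indepSet_le_one hQ (A := S.toFinset) (by simpa using hS)
  simp only [Set.mem_ofPred_eq, Set.indicator_apply, Finset.sum_boole]
  rw [← Finset.filter_mem_eq_inter] at h
  simpa using (Nat.cast_le (α := ℝ)).2 h

/-- The constant vector `1 / ω(G)` lies in the vertex packing polytope of a perfect graph: it is
the average of the colour classes of an optimal colouring. -/
theorem IsPerfect.const_mem_vertexPackingPolytope (hG : IsPerfect G) {K : Finset V}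
    (hK : G.IsMaximumClique K) (hpos : 0 < K.card) :
    (fun _ => 1 / (K.card : ℝ)) ∈ vertexPackingPolytope G := by
  obtain ⟨S, hS, hSw⟩ := hG.exists_weighted_coloring (fun _ => 1) K.card
    (fun Q hQ => by simpa using hK.maximum Q hQ)
  have hpos' : (0 : ℝ) < K.card := by exact_mod_cast hpos
  have h : (fun _ => 1 / (K.card : ℝ)) = ∑ i, (1 / (K.card : ℝ)) •
      (S i : Set V).indicator (fun _ => (1 : ℝ)) := by
    ext v
    have hv : ∑ i, (S i : Set V).indicator (fun _ => (1 : ℝ)) v = 1 := by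
      simp only [Set.indicator_apply, Finset.mem_coe, Finset.sum_boole]
      exact_mod_cast hSw v
    simp only [Finset.sum_apply, Pi.smul_apply, smul_eq_mul]
    rw [← Finset.mul_sum, hv, mul_one]
  rw [h]
  refine (convex_convexHull ℝ _).sum_mem (fun i _ => by positivity) ?_
    fun i _ => subset_convexHull ℝ _ ⟨S i, hS i, rfl⟩
  simp [hpos'.ne']

/-- Jensen's inequality for the logarithm: if the `P`-mean of `a` is at most `1 / m`, then the
`P`-mean of `log₂ (1 / a)` is at least `log₂ m`. -/
theorem logb_le_objective {ι : Type*} [Fintype ι] {P a : ι → ℝ} (hP : P ∈ stdSimplex ℝ ι)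
    (ha : ∀ v, 0 < P v → 0 < a v) {m : ℝ} (hm : 0 < m) (hle : ∑ v, P v * a v ≤ 1 / m) :
    Real.logb 2 m ≤ objective P a := by
  have h2 : 0 < Real.log 2 := Real.log_pos one_lt_two
  have hterm : ∀ v, P v * Real.logb 2 m + (P v - m * (P v * a v)) / Real.log 2
      ≤ P v * Real.logb 2 (1 / a v) := by
    intro v
    rcases (hP.1 v).eq_or_lt with h0 | h0
    · simp [← h0]
    · have hav := ha v h0
      have hlog := Real.log_le_sub_one_of_pos (mul_pos hm hav)
      rw [Real.log_mul hm.ne' hav.ne'] at hlog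
      rw [one_div, Real.logb_inv, Real.logb, Real.logb, ← sub_nonneg]
      have : P v * -(Real.log (a v) / Real.log 2) - (P v * (Real.log m / Real.log 2) +
          (P v - m * (P v * a v)) / Real.log 2)
          = P v * ((m * a v - 1) - (Real.log m + Real.log (a v))) / Real.log 2 := by ring
      rw [this]
      exact div_nonneg (mul_nonneg h0.le (by linarith)) h2.le
  have hsum := Finset.sum_le_sum fun v (_ : v ∈ Finset.univ) => hterm v
  rw [Finset.sum_add_distrib, ← Finset.sum_mul, hP.2, one_mul, ← Finset.sum_div,
    Finset.sum_sub_distrib, hP.2, ← Finset.mul_sum] at hsum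
  have hm1 : m * ∑ v, P v * a v ≤ 1 := by
    calc _ ≤ m * (1 / m) := by gcongr
      _ = 1 := by field_simp
  have : 0 ≤ (1 - m * ∑ v, P v * a v) / Real.log 2 := div_nonneg (by linarith) h2.le
  exact le_trans (by linarith) hsum

theorem IsPerfect.graphEntropy_le_logb (hG : IsPerfect G) {K : Finset V}
    (hK : G.IsMaximumClique K) (hpos : 0 < K.card) {P : V → ℝ} (hP : P ∈ stdSimplex ℝ V) :
    graphEntropy G P ≤ Real.logb 2 K.card := by
  refine (isLeast_graphEntropy G hP).2 ⟨fun _ => 1 / (K.card : ℝ),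
    ⟨hG.const_mem_vertexPackingPolytope hK hpos, fun _ _ => by positivity⟩, ?_⟩
  simp [objective, ← Finset.sum_mul, -Real.logb_inv, hP.2]

/-- The uniform distribution on a clique `K` has entropy at least `log₂ |K|`. -/
theorem exists_logb_le_graphEntropy {K : Finset V} (hK : G.IsClique (K : Set V))
    (hpos : 0 < K.card) :
    ∃ P ∈ stdSimplex ℝ V, Real.logb 2 K.card ≤ graphEntropy G P := by
  have hpos' : (0 : ℝ) < K.card := by exact_mod_cast hpos
  have hP : (fun v => if v ∈ K then 1 / (K.card : ℝ) else 0) ∈ stdSimplex ℝ V := by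
    refine ⟨fun v => ?_, ?_⟩
    · dsimp only
      split_ifs <;> positivity
    · simp [hpos'.ne']
  refine ⟨_, hP, ?_⟩
  obtain ⟨a, ha, hPa⟩ := (isLeast_graphEntropy G hP).1
  rw [← hPa]
  refine logb_le_objective hP ha.2 hpos' ?_
  have h := sum_clique_le_one ha.1 hK
  simp only [ite_mul, zero_mul, Finset.sum_ite_mem, Finset.univ_inter, ← Finset.mul_sum]
  exact mul_le_of_le_one_right (by positivity) h

theorem logb_le_graphEntropy_uniformDist [Nonempty V] {m : ℕ} (hm : 0 < m)
    (𝒬 : Finpartition (Finset.univ : Finset V))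
    (h𝒬 : ∀ Q ∈ 𝒬.parts, G.IsClique (Q : Set V) ∧ Q.card = m) :
    Real.logb 2 m ≤ graphEntropy G (uniformDist V) := by
  have hm' : (0 : ℝ) < m := by exact_mod_cast hm
  obtain ⟨a, ha, hPa⟩ := (isLeast_graphEntropy G (uniformDist_mem V)).1
  rw [← hPa]
  refine logb_le_objective (uniformDist_mem V) ha.2 hm' ?_
  have hcard : (Fintype.card V : ℝ) = 𝒬.parts.card * m := by
    have := 𝒬.sum_card_parts
    rw [Finset.sum_congr rfl fun Q hQ => (h𝒬 Q hQ).2, Finset.sum_const, Finset.card_univ] at this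
    exact_mod_cast this.symm
  have hsum : ∑ v, a v ≤ 𝒬.parts.card := by
    have h := Finset.sum_biUnion (f := a) 𝒬.disjoint
    rw [𝒬.biUnion_parts] at h
    rw [h]
    simpa using Finset.sum_le_card_nsmul _ _ 1 fun Q hQ => sum_clique_le_one ha.1 (h𝒬 Q hQ).1
  have hV : (0 : ℝ) < Fintype.card V := by exact_mod_cast Fintype.card_pos
  simp only [uniformDist, ← Finset.mul_sum]
  rw [one_div_mul_eq_div, div_le_div_iff₀ hV hm', one_mul, hcard]
  gcongr

/-- If `H(G,U) ≥ log₂ m` and the constant vector `1 / m` lies in `VP(G)`, then that vector is a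
minimizer, and moving from it towards the characteristic vector of an independent set `A` shows
that `A` has at most `|V| / m` vertices. -/
theorem card_mul_le_of_logb_le_graphEntropy [Nonempty V] {m : ℕ} (hm : 0 < m)
    (hconst : (fun _ => 1 / (m : ℝ)) ∈ vertexPackingPolytope G)
    (hH : Real.logb 2 m ≤ graphEntropy G (uniformDist V)) {A : Finset V}
    (hA : G.IsIndepSet (A : Set V)) : A.card * m ≤ Fintype.card V := by
  have hm1 : (1 : ℝ) ≤ m := by exact_mod_cast hm
  have hm' : (0 : ℝ) < m := by linarith
  have hV : (0 : ℝ) < Fintype.card V := by exact_mod_cast Fintype.card_pos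
  have h2 : 0 < Real.log 2 := Real.log_pos one_lt_two
  have hcompl : ((Aᶜ).card : ℝ) = Fintype.card V - A.card := by
    rw [Finset.card_compl, Nat.cast_sub (Finset.card_le_univ A)]
  -- The first-order condition, with an error term linear in the step `t`.
  have key : ∀ t ∈ Set.Ioo (0 : ℝ) 1,
      A.card * ((m - 1) * (1 - t)) ≤ (Fintype.card V - A.card) * (1 + t * (m - 1)) := by
    intro t ht
    obtain ⟨ht0, ht1⟩ := ht
    have hs : 0 < 1 + t * ((m : ℝ) - 1) := by nlinarith
    set b : V → ℝ := (1 - t) • (fun _ => 1 / (m : ℝ)) +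
      t • (A : Set V).indicator (fun _ => (1 : ℝ)) with hb
    have hbA : ∀ v ∈ A, b v = (1 + t * (m - 1)) / m := fun v hv => by
      simp [hb, hv]; field_simp; ring
    have hbA' : ∀ v ∈ Aᶜ, b v = (1 - t) / m := fun v hv => by
      simp [hb, Finset.mem_compl.1 hv]; field_simp
    have hbmem : b ∈ vertexPackingPolytope G :=
      (convex_convexHull ℝ _) hconst (subset_convexHull ℝ _ ⟨A, hA, rfl⟩) (by linarith) ht0.le
        (by ring)
    have hbpos : ∀ v, 0 < b v := fun v => by
      by_cases hv : v ∈ A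
      · rw [hbA v hv]; positivity
      · rw [hbA' v (Finset.mem_compl.2 hv)]; exact div_pos (by linarith) hm'
    have hle : Real.logb 2 m ≤ objective (uniformDist V) b :=
      hH.trans ((isLeast_graphEntropy G (uniformDist_mem V)).2
        ⟨b, ⟨hbmem, fun v _ => hbpos v⟩, rfl⟩)
    have hobj : objective (uniformDist V) b = (1 / Fintype.card V) *
        (A.card * ((Real.log m - Real.log (1 + t * (m - 1))) / Real.log 2) +
          (Fintype.card V - A.card) * ((Real.log m - Real.log (1 - t)) / Real.log 2)) := by
      unfold objective uniformDist
      rw [← Finset.mul_sum, ← Finset.sum_add_sum_compl A]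
      have e1 : ∀ v ∈ A, Real.logb 2 (1 / b v) =
          (Real.log m - Real.log (1 + t * (m - 1))) / Real.log 2 := fun v hv => by
        rw [hbA v hv, one_div_div, Real.logb, Real.log_div hm'.ne' hs.ne']
      have e2 : ∀ v ∈ Aᶜ, Real.logb 2 (1 / b v) =
          (Real.log m - Real.log (1 - t)) / Real.log 2 := fun v hv => by
        rw [hbA' v hv, one_div_div, Real.logb, Real.log_div hm'.ne' (by linarith)]
      rw [Finset.sum_congr rfl e1, Finset.sum_congr rfl e2, Finset.sum_const, Finset.sum_const,
        nsmul_eq_mul, nsmul_eq_mul, hcompl]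
    have hlog : A.card * Real.log (1 + t * (m - 1)) +
        (Fintype.card V - A.card) * Real.log (1 - t) ≤ 0 := by
      rw [hobj, Real.logb, one_div_mul_eq_div, div_le_div_iff₀ h2 hV] at hle
      field_simp at hle
      linarith
    have l1 := Real.one_sub_inv_le_log_of_pos hs
    have l2 := Real.one_sub_inv_le_log_of_pos (show 0 < 1 - t by linarith)
    have hA0 : (0 : ℝ) ≤ A.card := by positivity
    have hA1 : (0 : ℝ) ≤ Fintype.card V - A.card := hcompl ▸ by positivity
    have l3 := mul_le_mul_of_nonneg_left l1 hA0
    have l4 := mul_le_mul_of_nonneg_left l2 hA1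
    have e1 : 1 - (1 + t * ((m : ℝ) - 1))⁻¹ = t * (m - 1) / (1 + t * (m - 1)) := by
      field_simp; ring
    have e2 : 1 - (1 - t)⁻¹ = -(t / (1 - t)) := by
      have : 1 - t ≠ 0 := by linarith
      field_simp; ring
    rw [e1] at l3
    rw [e2] at l4
    have l5 : A.card * (t * (m - 1)) / (1 + t * (m - 1)) ≤
        (Fintype.card V - A.card) * t / (1 - t) := by
      rw [mul_div_assoc (A.card : ℝ), mul_div_assoc (Fintype.card V - A.card : ℝ)]; linarith
    rw [div_le_div_iff₀ hs (by linarith)] at l5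
    refine le_of_mul_le_mul_left ?_ ht0
    linarith
  -- Let the step tend to `0`.
  have hlim : (A.card * (((m : ℝ) - 1) * (1 - 0)) : ℝ) ≤
      (Fintype.card V - A.card) * (1 + 0 * ((m : ℝ) - 1)) := by
    refine le_of_tendsto_of_tendsto (b := nhdsWithin (0 : ℝ) (Set.Ioi 0))
      (f := fun t : ℝ => A.card * (((m : ℝ) - 1) * (1 - t)))
      (g := fun t : ℝ => (Fintype.card V - A.card) * (1 + t * ((m : ℝ) - 1)))
      (Continuous.tendsto (by fun_prop) 0 |>.mono_left nhdsWithin_le_nhds)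
      (Continuous.tendsto (by fun_prop) 0 |>.mono_left nhdsWithin_le_nhds) ?_
    filter_upwards [Ioo_mem_nhdsGT one_pos] with t ht using key t ht
  have : (A.card * m : ℝ) ≤ Fintype.card V := by linarith
  exact_mod_cast this

end GraphEntropy

theorem mainTheorem1 {V : Type*} [Fintype V] [DecidableEq V] [Nonempty V]
    (G : SimpleGraph V) (hG : GraphEntropy.IsPerfect G) :
    GraphEntropy.IsSymmetric G ↔
      ∃ 𝒬 : Finpartition (Finset.univ : Finset V), ∀ Q ∈ 𝒬.parts, G.IsMaximumClique Q := by
  obtain ⟨K, hK⟩ := G.maximumClique_exists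
  have hpos : 0 < K.card := by
    obtain ⟨v⟩ := ‹Nonempty V›
    simpa using hK.maximum {v} (by simp)
  constructor
  · intro h
    obtain ⟨P, hP, hle⟩ := GraphEntropy.exists_logb_le_graphEntropy hK.isClique hpos
    exact hG.exists_finpartition hK hpos fun A hA =>
      GraphEntropy.card_mul_le_of_logb_le_graphEntropy hpos
        (hG.const_mem_vertexPackingPolytope hK hpos) (hle.trans (h.2 P hP)) hA
  · rintro ⟨𝒬, h𝒬⟩
    refine ⟨GraphEntropy.uniformDist_mem V, fun P hP =>
      (hG.graphEntropy_le_logb hK hpos hP).trans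
        (GraphEntropy.logb_le_graphEntropy_uniformDist hpos 𝒬 fun Q hQ => ⟨(h𝒬 Q hQ).isClique, ?_⟩)⟩
    exact le_antisymm (hK.maximum Q (h𝒬 Q hQ).isClique) ((h𝒬 Q hQ).maximum K hK.isClique)
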